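/- For integers $k\ge 1$ and $n\ge 0$, let $\phi_k(n)$ denote the number of generalized Frobenius partitions of $n$ that allow up to $k$ repetitions of an integer in either row, that is, the number of two-rowed arrays $$\begin{pmatrix} a_1 & a_2 & \cdots & a_r\\ b_1 & b_2 & \cdots & b_r\end{pmatrix}$$ of non-negative integers with $r\ge 0$, $a_1\ge a_2\ge\cdots\ge a_r$, $b_1\ge b_2\ge\cdots\ge b_r$, in which no integer occurs more than $k$ times in the same row, and $n=r+\sum_{i=1}^r a_i+\sum_{i=1}^r b_i$. Then, for all $n\ge 0$, $$\phi_4(10n+6)\equiv 0 \pmod 5.$$ -/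

import Mathlib

/-- Generalized Frobenius partitions of `n` that allow up to `k` repetitions of an integer in
either row: two-rowed arrays
`(a₁ a₂ ⋯ aᵣ ; b₁ b₂ ⋯ bᵣ)` of non-negative integers, both rows of the same length `r ≥ 0` and
in weakly decreasing order, no integer occurring more than `k` times in a row, with
`n = r + ∑ aᵢ + ∑ bᵢ`. A row, being weakly decreasing, is recorded as the multiset of its
entries: `p.1` is the top row and `p.2` is the bottom row. -/
def frobeniusPartitions (k n : ℕ) : Set (Multiset ℕ × Multiset ℕ) :=
  {p | p.1.card = p.2.card ∧
    (∀ a : ℕ, p.1.count a ≤ k) ∧ (∀ b : ℕ, p.2.count b ≤ k) ∧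
    p.1.card + p.1.sum + p.2.sum = n}

/-- There are only finitely many of them, so that counting them with `Set.ncard` is meaningful. -/
theorem frobeniusPartitions_finite (k n : ℕ) : (frobeniusPartitions k n).Finite := by
  have key : ∀ s : Multiset ℕ, s.card ≤ n → s.sum ≤ n → s ≤ n • Multiset.range (n + 1) := by
    intro s hc hs
    rw [Multiset.le_iff_count]
    intro a
    by_cases ha : a ∈ s
    · have h1 : a ≤ n := (Multiset.le_sum_of_mem ha).trans hs
      have h2 : a ∈ Multiset.range (n + 1) := Multiset.mem_range.2 (by omega)
      have h3 : 1 ≤ (Multiset.range (n + 1)).count a := Multiset.one_le_count_iff_mem.2 h2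
      rw [Multiset.count_nsmul]
      calc s.count a ≤ n := (Multiset.count_le_card a s).trans hc
        _ ≤ n * (Multiset.range (n + 1)).count a := Nat.le_mul_of_pos_right n h3
    · simp [Multiset.count_eq_zero_of_notMem ha]
  refine ((Set.finite_Iic (n • Multiset.range (n + 1))).prod
    (Set.finite_Iic (n • Multiset.range (n + 1)))).subset ?_
  rintro ⟨s, t⟩ ⟨h, -, -, hn⟩
  simp only at h hn
  exact ⟨key s (by omega) (by omega), key t (by omega) (by omega)⟩

/-- `frobeniusPhi k n` is `φ_k(n)`, the number of generalized Frobenius partitions of `n` that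
allow up to `k` repetitions of an integer in either row. -/
noncomputable def frobeniusPhi (k n : ℕ) : ℕ := (frobeniusPartitions k n).ncard

/-!
Modulo `5` one has `1 + x + x² + x³ + x⁴ = (1 - x)⁴`. The generating function `F` of `φ₄` is the
constant term in `z` of a product of factors `1 + x + ⋯ + x⁴` with `x = z q ^ (i + 1)` and
`x = z⁻¹ q ^ i`, hence modulo `5` the constant term of the fourth power of the product in the Jacobi
triple product identity. With `f = ∏ (1 - q ^ n)` and `Θ` the theta series of the root lattice `A₃`
this gives `F f⁴ = Θ` modulo `5` (`phiFourSeries_mul_eulerProd_pow_four`).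

Put `φ(q) = ∑ q ^ (x²)` and `S(q) = ∑ q ^ (x (x + 1))`, sums over all integers. Cutting lattices into
cosets according to parities gives the classical relations between `φ` and `S`, the value
`Θ(q) = φ(q²)³ + 3 q φ(q²) S(q²)²` (`thetaA3_eq`), and `φ(q) φ(-q) = φ(-q²)²`. Gauss's product formula
`φ(-q) f(q²) = f(q)²` (`evalNegHom_thetaPhi_mul_expand_eulerProd`) then turns `F f⁴ = Θ` into
`F(q) φ(-q²)⁴ f(q²)² = Θ(q) φ(q)²`, whose left hand factor is a series in `q²`. So the even part `G` of
`F` satisfies `G(q) φ(-q)⁴ f(q)² = 4 φ(q)⁵ - 3 φ(q) φ(-q)⁴`. Multiplying by `φ(-q) f(q)³` and using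
`g(q)⁵ = g(q⁵)` modulo `5` yields (`evenPart_phiFourSeries_mul`)

`G(q) φ(-q⁵) f(q⁵) = 4 φ(q⁵) φ(-q) f(q)³ - 3 φ(-q⁵) φ(q) f(q)³`.

The coefficient of `F` at `10 n + 6` is that of `G` at `5 n + 3`, so it is enough that the coefficients
of `φ(±q) f(q)³` at exponents congruent to `3` vanish
(`coeff_qSeries_sq_mul_eulerProd_pow_three`). By Jacobi's identity
`2 f³ = ∑ (-1) ^ j (2 j + 1) q ^ (j (j + 1) / 2)` the terms of this product have exponent
`e = x² + j (j + 1) / 2` and coefficient `± (2 j + 1)`; here `8 e + 1 = 8 x² + (2 j + 1)²`, which for `e`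
congruent to `3` is divisible by `5` only if `2 j + 1` is, because `-8` is not a square modulo `5`.

The product formulas all come from one finite form of the Jacobi triple product identity in an
arbitrary commutative ring (`prod_mul_prod_eq_sum_gaussBinom`), used in Laurent polynomials over
power series, in power series, and in dual numbers over power series, where it is differentiated.
-/

open PowerSeries

/-! ### Power series given by exponents and weights -/

section QSeries
variable {R ι κ : Type*} [CommRing R]

/-- The power series `∑ w i * X ^ e i` over an arbitrary index type. Exponents are integers, so that
they can be manipulated in a ring; indices with negative exponent are ignored, and the coefficients
are junk values where a fibre of `e` is infinite, both of which `IsExponent` excludes. -/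
noncomputable def qSeries (e : ι → ℤ) (w : ι → R) : R⟦X⟧ :=
  PowerSeries.mk fun n ↦ ∑ᶠ i ∈ {i | e i = (n : ℤ)}, w i

/-- The exponent function `e` is nonnegative and takes small values only finitely often. -/
structure IsExponent (e : ι → ℤ) : Prop where
  nonneg : ∀ i, 0 ≤ e i
  finite_le : ∀ n : ℤ, {i | e i ≤ n}.Finite

lemma coeff_qSeries (e : ι → ℤ) (w : ι → R) (n : ℕ) :
    coeff n (qSeries e w) = ∑ᶠ i ∈ {i | e i = (n : ℤ)}, w i := by
  simp [qSeries]

lemma coeff_qSeries_eq_sum {e : ι → ℤ} {w : ι → R} {n : ℕ} (s : Finset ι)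
    (hs : ∀ i, e i = n → i ∈ s) :
    coeff n (qSeries e w) = ∑ i ∈ s, if e i = n then w i else 0 := by
  rw [coeff_qSeries, ← Finset.sum_filter]
  apply finsum_mem_eq_sum_of_inter_support_eq
  ext i
  simp only [Set.mem_inter_iff, Set.mem_ofPred_eq, Finset.coe_filter]
  grind

lemma qSeries_equiv {e : ι → ℤ} {w : ι → R} {e' : κ → ℤ} {w' : κ → R} (E : ι ≃ κ)
    (he : ∀ i, e' (E i) = e i) (hw : ∀ i, w' (E i) = w i) :
    qSeries e w = qSeries e' w' := by
  ext n
  rw [coeff_qSeries, coeff_qSeries]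
  refine finsum_mem_eq_of_bijOn E ⟨fun i hi ↦ ?_, E.injective.injOn, fun k hk ↦ ?_⟩ ?_
  · simpa [he] using hi
  · exact ⟨E.symm k, by simpa [← he] using hk, by simp⟩
  · intro i _; exact (hw i).symm

lemma IsExponent.add {e : ι → ℤ} {e' : κ → ℤ} (he : IsExponent e) (he' : IsExponent e') :
    IsExponent fun p : ι × κ ↦ e p.1 + e' p.2 where
  nonneg p := add_nonneg (he.nonneg _) (he'.nonneg _)
  finite_le n := by
    refine ((he.finite_le n).prod (he'.finite_le n)).subset ?_
    rintro ⟨i, j⟩ h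
    have h1 := he.nonneg i
    have h2 := he'.nonneg j
    simp only [Set.mem_ofPred_eq] at h
    exact ⟨by simp only [Set.mem_ofPred_eq]; linarith, by simp only [Set.mem_ofPred_eq]; linarith⟩

lemma qSeries_mul {e : ι → ℤ} {e' : κ → ℤ} (he : IsExponent e) (he' : IsExponent e')
    (w : ι → R) (w' : κ → R) :
    qSeries e w * qSeries e' w' =
      qSeries (fun p : ι × κ ↦ e p.1 + e' p.2) (fun p ↦ w p.1 * w' p.2) := by
  ext n
  set s := (he.finite_le n).toFinset with hs
  set t := (he'.finite_le n).toFinset with ht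
  have h1 : ∀ p ∈ Finset.HasAntidiagonal.antidiagonal n,
      coeff p.1 (qSeries e w) * coeff p.2 (qSeries e' w') =
      ∑ x ∈ s ×ˢ t, if (e x.1).toNat = p.1 ∧ (e' x.2).toNat = p.2 then w x.1 * w' x.2 else 0 := by
    intro p hp
    rw [Finset.HasAntidiagonal.mem_antidiagonal] at hp
    rw [coeff_qSeries_eq_sum s, coeff_qSeries_eq_sum t, Finset.sum_mul_sum, Finset.sum_product]
    · refine Finset.sum_congr rfl fun i _ ↦ Finset.sum_congr rfl fun j _ ↦ ?_
      have h1 := he.nonneg i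
      have h2 := he'.nonneg j
      by_cases ha : e i = p.1 <;> by_cases hb : e' j = p.2 <;> simp [ha, hb] <;> omega
    · intro j hj; simp [ht]; omega
    · intro i hi; simp [hs]; omega
  rw [coeff_mul, Finset.sum_congr rfl h1, Finset.sum_comm, coeff_qSeries_eq_sum (s ×ˢ t)]
  · refine Finset.sum_congr rfl fun x _ ↦ ?_
    have h1 := he.nonneg x.1
    have h2 := he'.nonneg x.2
    split_ifs with h
    · rw [Finset.sum_eq_single ((e x.1).toNat, (e' x.2).toNat)]
      · simp
      · rintro ⟨a, b⟩ _ hab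
        rw [if_neg]
        rintro ⟨rfl, rfl⟩
        exact hab rfl
      · intro hn
        exact absurd (Finset.HasAntidiagonal.mem_antidiagonal.2 (by simp only; omega)) hn
    · refine Finset.sum_eq_zero fun p hp ↦ if_neg ?_
      rw [Finset.HasAntidiagonal.mem_antidiagonal] at hp
      omega
  · rintro ⟨i, j⟩ h
    have h1 := he.nonneg i
    have h2 := he'.nonneg j
    simp only at h
    simp only [hs, ht, Finset.mem_product, Set.Finite.mem_toFinset, Set.mem_ofPred_eq]
    omega

lemma qSeries_sumElim {e : ι → ℤ} {e' : κ → ℤ} (he : IsExponent e) (he' : IsExponent e')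
    (w : ι → R) (w' : κ → R) :
    qSeries (Sum.elim e e') (Sum.elim w w') = qSeries e w + qSeries e' w' := by
  ext n
  have hs : ∀ i, e i = n → i ∈ (he.finite_le n).toFinset := fun i hi ↦ by simp [hi]
  have ht : ∀ i, e' i = n → i ∈ (he'.finite_le n).toFinset := fun i hi ↦ by simp [hi]
  rw [map_add, coeff_qSeries_eq_sum _ hs, coeff_qSeries_eq_sum _ ht,
    coeff_qSeries_eq_sum ((he.finite_le n).toFinset.disjSum (he'.finite_le n).toFinset),
    Finset.sum_disjSum]
  · rfl
  · rintro (i | i) h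
    · simpa using hs i h
    · simpa using ht i h

lemma expand_qSeries {m : ℕ} (hm : m ≠ 0) (e : ι → ℤ) (w : ι → R) :
    expand m hm (qSeries e w) = qSeries (fun i ↦ m * e i) w := by
  ext n
  rw [coeff_expand, coeff_qSeries, coeff_qSeries]
  have hm' : (m : ℤ) ≠ 0 := by exact_mod_cast hm
  split_ifs with h
  · obtain ⟨k, rfl⟩ := h
    rw [Nat.mul_div_cancel_left _ (Nat.pos_of_ne_zero hm)]
    simp only [Nat.cast_mul, mul_right_inj' hm']
  · have : {i | (m : ℤ) * e i = n} = ∅ := by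
      ext i
      simp only [Set.mem_ofPred_eq, Set.mem_empty_iff_false, iff_false]
      intro hi
      exact h (by exact_mod_cast Dvd.intro _ hi)
    simp [this]

lemma X_mul_qSeries {e : ι → ℤ} (he : ∀ i, 0 ≤ e i) (w : ι → R) :
    X * qSeries e w = qSeries (fun i ↦ e i + 1) w := by
  ext n
  cases n with
  | zero =>
    have : {i | e i + 1 = ((0 : ℕ) : ℤ)} = ∅ := by
      ext i
      have := he i
      simp only [Set.mem_ofPred_eq, Set.mem_empty_iff_false, iff_false]
      push_cast
      omega
    rw [coeff_qSeries, this]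
    simp
  | succ n =>
    rw [coeff_succ_X_mul, coeff_qSeries, coeff_qSeries]
    congr! 4 with i
    simp

lemma qSeries_add {e : ι → ℤ} (he : IsExponent e) (w w' : ι → R) :
    qSeries e w + qSeries e w' = qSeries e (fun i ↦ w i + w' i) := by
  ext n
  have hs : ∀ i, e i = n → i ∈ (he.finite_le n).toFinset := fun i hi ↦ by simp [hi]
  rw [map_add, coeff_qSeries_eq_sum _ hs, coeff_qSeries_eq_sum _ hs, coeff_qSeries_eq_sum _ hs,
    ← Finset.sum_add_distrib]
  refine Finset.sum_congr rfl fun i _ ↦ ?_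
  split_ifs <;> simp

lemma evalNegHom_qSeries {e : ι → ℤ} (he : IsExponent e) (w : ι → R) :
    evalNegHom (qSeries e w) = qSeries e (fun i ↦ (-1) ^ (e i).toNat * w i) := by
  ext n
  have hs : ∀ i, e i = n → i ∈ (he.finite_le n).toFinset := fun i hi ↦ by simp [hi]
  rw [evalNegHom, coeff_rescale, coeff_qSeries_eq_sum _ hs, coeff_qSeries_eq_sum _ hs,
    Finset.mul_sum]
  refine Finset.sum_congr rfl fun i _ ↦ ?_
  split_ifs with h <;> simp [h]

/-- Truncation of a series: only the terms of exponent less than `N` matter modulo `X ^ N`. -/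
lemma X_pow_dvd_qSeries_sub_sum {e : ι → ℤ} (he : ∀ i, 0 ≤ e i) (w : ι → R) (N : ℕ) (s : Finset ι)
    (hs : ∀ i, e i < N → i ∈ s) :
    X ^ N ∣ qSeries e w - ∑ i ∈ s, C (w i) * X ^ (e i).toNat := by
  rw [X_pow_dvd_iff]
  intro n hn
  rw [map_sub, map_sum, coeff_qSeries_eq_sum s fun i hi ↦ hs i (by omega), sub_eq_zero]
  refine Finset.sum_congr rfl fun i _ ↦ ?_
  have := he i
  rw [coeff_C_mul, coeff_X_pow]
  split_ifs with h h' h' <;> first | omega | simp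

lemma eq_of_forall_X_pow_dvd_sub {a b : R⟦X⟧} (h : ∀ N, X ^ N ∣ a - b) : a = b := by
  ext n
  have := X_pow_dvd_iff.1 (h (n + 1)) n (by omega)
  rwa [map_sub, sub_eq_zero] at this

end QSeries

/-! ### Theta series and their dissections by parity -/

section Theta
variable (R : Type*) [CommRing R]

lemma isExponent_of_abs_le {e : ℤ → ℤ} (h : ∀ x, |x| ≤ e x + 1) (h0 : ∀ x, 0 ≤ e x) :
    IsExponent e where
  nonneg := h0
  finite_le n := by
    refine (Set.finite_Icc (-(n + 1)) (n + 1)).subset fun x hx ↦ ?_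
    have := abs_le.1 (h x)
    simp only [Set.mem_ofPred_eq] at hx
    exact ⟨by linarith, by linarith⟩

lemma abs_le_sq (x : ℤ) : |x| ≤ x ^ 2 + 1 := by
  rw [← sq_abs]
  nlinarith [sq_nonneg (|x| - 1), abs_nonneg x]

lemma isExponent_sq : IsExponent fun x : ℤ ↦ x ^ 2 :=
  isExponent_of_abs_le abs_le_sq fun x ↦ sq_nonneg x

lemma Int.mul_add_one_nonneg (x : ℤ) : 0 ≤ x * (x + 1) := by
  rcases le_or_gt 0 x with h | h <;> nlinarith

lemma isExponent_pronic : IsExponent fun x : ℤ ↦ x * (x + 1) :=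
  isExponent_of_abs_le
    (fun x ↦ by rcases abs_cases x with h | h <;> rw [h.1] <;> nlinarith [sq_nonneg (x + 1)])
    Int.mul_add_one_nonneg

/-- Ramanujan's theta function `φ(X)`, the sum of `X ^ (x ^ 2)` over all integers `x`. -/
noncomputable def thetaPhi : R⟦X⟧ := qSeries (fun x : ℤ ↦ x ^ 2) 1

/-- The sum of `X ^ (x * (x + 1))` over all integers `x`, which is `2 ψ(X ^ 2)` in terms of
Ramanujan's theta function `ψ`. -/
noncomputable def thetaPronic : R⟦X⟧ := qSeries (fun x : ℤ ↦ x * (x + 1)) 1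

lemma IsExponent.const_mul {ι : Type*} {e : ι → ℤ} (he : IsExponent e) {m : ℤ} (hm : 0 < m) :
    IsExponent fun i ↦ m * e i where
  nonneg i := mul_nonneg hm.le (he.nonneg i)
  finite_le n := (he.finite_le n).subset fun i hi ↦ by
    have := he.nonneg i
    simp only [Set.mem_ofPred_eq] at hi ⊢
    nlinarith

lemma IsExponent.add_const {ι : Type*} {e : ι → ℤ} (he : IsExponent e) {m : ℤ} (hm : 0 ≤ m) :
    IsExponent fun i ↦ e i + m where
  nonneg i := add_nonneg (he.nonneg i) hm
  finite_le n := (he.finite_le n).subset fun i hi ↦ by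
    simp only [Set.mem_ofPred_eq] at hi ⊢
    linarith

/-- `ℤ` is the disjoint union of the even and the odd integers. -/
noncomputable def evenOddEquiv : ℤ ⊕ ℤ ≃ ℤ := Equiv.ofBijective
    (Sum.elim (fun x ↦ 2 * x) (fun x ↦ 2 * x + 1)) <| by
  refine ⟨?_, fun x ↦ ?_⟩
  · rintro (x | x) (y | y) h <;> simp only [Sum.elim_inl, Sum.elim_inr] at h <;>
      first | omega | (congr 1; omega)
  · rcases Int.even_or_odd' x with ⟨k, hk | hk⟩
    · exact ⟨.inl k, hk.symm⟩
    · exact ⟨.inr k, hk.symm⟩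

lemma evenOddEquiv_inl (x : ℤ) : evenOddEquiv (.inl x) = 2 * x := rfl
lemma evenOddEquiv_inr (x : ℤ) : evenOddEquiv (.inr x) = 2 * x + 1 := rfl

lemma thetaPhi_eq : thetaPhi R =
    expand 4 four_ne_zero (thetaPhi R) + X * expand 4 four_ne_zero (thetaPronic R) := by
  have h1 := isExponent_sq.const_mul (m := 4) (by norm_num)
  have h2 := isExponent_pronic.const_mul (m := 4) (by norm_num)
  rw [thetaPhi, thetaPronic, expand_qSeries, expand_qSeries, Nat.cast_ofNat,
    X_mul_qSeries h2.nonneg, ← qSeries_sumElim h1 (h2.add_const zero_le_one)]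
  refine (qSeries_equiv evenOddEquiv ?_ ?_).symm
  · rintro (x | x) <;> simp only [evenOddEquiv_inl, evenOddEquiv_inr, Sum.elim_inl, Sum.elim_inr]
      <;> ring
  · rintro (x | x) <;> simp

/-- `ℤ²` is the disjoint union of the sublattice of pairs with even sum and its coset of pairs
with odd sum; both are parametrized by `ℤ²` through a rotation. -/
noncomputable def parityEquiv : (ℤ × ℤ) ⊕ (ℤ × ℤ) ≃ ℤ × ℤ := Equiv.ofBijective
    (Sum.elim (fun p ↦ (p.1 + p.2, p.1 - p.2)) (fun p ↦ (p.1 + p.2 + 1, p.1 - p.2))) <| by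
  constructor
  · rintro (⟨x, y⟩ | ⟨x, y⟩) (⟨z, w⟩ | ⟨z, w⟩) h <;>
      simp only [Sum.elim_inl, Sum.elim_inr, Prod.mk.injEq] at h <;>
      first | omega | (congr 2 <;> omega)
  · rintro ⟨x, y⟩
    rcases Int.even_or_odd' (x + y) with ⟨k, hk | hk⟩
    · exact ⟨.inl (k, x - k), by simp only [Sum.elim_inl]; congr 1 <;> omega⟩
    · exact ⟨.inr (k, x - k - 1), by simp only [Sum.elim_inr]; congr 1 <;> omega⟩

lemma parityEquiv_inl (p : ℤ × ℤ) : parityEquiv (.inl p) = (p.1 + p.2, p.1 - p.2) := rfl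
lemma parityEquiv_inr (p : ℤ × ℤ) : parityEquiv (.inr p) = (p.1 + p.2 + 1, p.1 - p.2) := rfl

/-- A second parametrization of the two cosets, in which that of the pairs with odd sum is
composed with the reflection `y ↦ -1 - y`, under which `y * (y + 1)` is invariant. -/
noncomputable def parityReflectEquiv : (ℤ × ℤ) ⊕ (ℤ × ℤ) ≃ ℤ × ℤ := Equiv.ofBijective
    (Sum.elim (fun p ↦ (p.1 + p.2, p.1 - p.2)) (fun p ↦ (p.1 + p.2, p.2 - p.1 - 1))) <| by
  constructor
  · rintro (⟨x, y⟩ | ⟨x, y⟩) (⟨z, w⟩ | ⟨z, w⟩) h <;>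
      simp only [Sum.elim_inl, Sum.elim_inr, Prod.mk.injEq] at h <;>
      first | omega | (congr 2 <;> omega)
  · rintro ⟨x, y⟩
    rcases Int.even_or_odd' (x + y) with ⟨k, hk | hk⟩
    · exact ⟨.inl (k, x - k), by simp only [Sum.elim_inl]; congr 1 <;> omega⟩
    · exact ⟨.inr (x - k - 1, k + 1), by simp only [Sum.elim_inr]; congr 1 <;> omega⟩

lemma parityReflectEquiv_inl (p : ℤ × ℤ) :
    parityReflectEquiv (.inl p) = (p.1 + p.2, p.1 - p.2) := rfl
lemma parityReflectEquiv_inr (p : ℤ × ℤ) :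
    parityReflectEquiv (.inr p) = (p.1 + p.2, p.2 - p.1 - 1) := rfl

lemma thetaPhi_sq : thetaPhi R ^ 2 =
    expand 2 two_ne_zero (thetaPhi R) ^ 2 + X * expand 2 two_ne_zero (thetaPronic R) ^ 2 := by
  have h1 := isExponent_sq.const_mul (m := 2) (by norm_num)
  have h2 := isExponent_pronic.const_mul (m := 2) (by norm_num)
  rw [pow_two (thetaPhi R), pow_two (expand _ _ _), pow_two (expand _ _ (thetaPronic R)),
    thetaPhi, thetaPronic, expand_qSeries, expand_qSeries, Nat.cast_ofNat,
    qSeries_mul isExponent_sq isExponent_sq, qSeries_mul h1 h1, qSeries_mul h2 h2,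
    X_mul_qSeries (h2.add h2).nonneg,
    ← qSeries_sumElim (h1.add h1) ((h2.add h2).add_const zero_le_one)]
  refine (qSeries_equiv parityEquiv ?_ ?_).symm
  · rintro (x | x) <;> simp only [parityEquiv_inl, parityEquiv_inr, Sum.elim_inl, Sum.elim_inr]
      <;> ring
  · rintro (x | x) <;> simp

lemma thetaPronic_sq : thetaPronic R ^ 2 =
    2 * (expand 2 two_ne_zero (thetaPronic R) * expand 2 two_ne_zero (thetaPhi R)) := by
  have h1 := isExponent_sq.const_mul (m := 2) (by norm_num)
  have h2 := isExponent_pronic.const_mul (m := 2) (by norm_num)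
  rw [pow_two (thetaPronic R), two_mul, thetaPhi, thetaPronic, expand_qSeries, expand_qSeries,
    Nat.cast_ofNat, qSeries_mul isExponent_pronic isExponent_pronic, qSeries_mul h2 h1,
    ← qSeries_sumElim (h2.add h1) (h2.add h1)]
  refine (qSeries_equiv parityReflectEquiv ?_ ?_).symm
  · rintro (x | x) <;>
      simp only [parityReflectEquiv_inl, parityReflectEquiv_inr, Sum.elim_inl, Sum.elim_inr]
      <;> ring
  · rintro (x | x) <;> simp

/-- The theta series of the root lattice `A₃`, the lattice of vectors `(a, b, c, d)` of `ℤ⁴` with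
`a + b + c + d = 0`, with respect to half the Euclidean norm. The coordinate `d` is eliminated. -/
noncomputable def thetaA3 : R⟦X⟧ :=
  qSeries (fun p : ℤ × ℤ × ℤ ↦
    p.1 ^ 2 + p.2.1 ^ 2 + p.2.2 ^ 2 + p.1 * p.2.1 + p.1 * p.2.2 + p.2.1 * p.2.2) 1

/-- The coordinates `x = a + b`, `y = a + c`, `z = b + c` identify the lattice `A₃` with the
lattice of integer triples with even sum. The four parts are: all of `x`, `y`, `z` even, only `z` even,
only `x` even, only `y` even. -/
noncomputable def a3Equiv : (ℤ × ℤ × ℤ) ⊕ (ℤ × ℤ × ℤ) ⊕ (ℤ × ℤ × ℤ) ⊕ (ℤ × ℤ × ℤ) ≃ ℤ × ℤ × ℤ :=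
  Equiv.ofBijective
    (Sum.elim (fun (w, u, v) ↦ (u + v - w, u - v + w, -u + v + w))
    (Sum.elim (fun (w, u, v) ↦ (u + v - w + 1, u - v + w, -u + v + w))
    (Sum.elim (fun (w, u, v) ↦ (u - v + w, -u + v + w, u + v - w + 1))
      (fun (w, u, v) ↦ (u - v + w, u + v - w + 1, -u + v + w))))) <| by
  constructor
  · rintro (⟨x, y, z⟩ | ⟨x, y, z⟩ | ⟨x, y, z⟩ | ⟨x, y, z⟩)
      (⟨x', y', z'⟩ | ⟨x', y', z'⟩ | ⟨x', y', z'⟩ | ⟨x', y', z'⟩) h <;>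
      simp only [Sum.elim_inl, Sum.elim_inr, Prod.mk.injEq] at h <;>
      first | omega | (simp only [Sum.inl.injEq, Sum.inr.injEq, Prod.mk.injEq]; omega)
  · rintro ⟨a, b, c⟩
    rcases Int.even_or_odd' (a + b) with ⟨k, hk | hk⟩ <;>
      rcases Int.even_or_odd' (a + c) with ⟨l, hl | hl⟩
    · exact ⟨.inl (k + l - a, k, l), by simp only [Sum.elim_inl, Prod.mk.injEq]; omega⟩
    · exact ⟨.inr (.inr (.inl (k, l, k + l - a))),
        by simp only [Sum.elim_inl, Sum.elim_inr, Prod.mk.injEq]; omega⟩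
    · exact ⟨.inr (.inr (.inr (l, k, k + l - a))),
        by simp only [Sum.elim_inr, Prod.mk.injEq]; omega⟩
    · exact ⟨.inr (.inl (k + l + 1 - a, k, l)),
        by simp only [Sum.elim_inl, Sum.elim_inr, Prod.mk.injEq]; omega⟩

/-- By `a3Equiv`, `A₃` is a union of four cosets of an orthogonal lattice. -/
lemma thetaA3_eq : thetaA3 R = expand 2 two_ne_zero (thetaPhi R) ^ 3 +
    3 * (X * (expand 2 two_ne_zero (thetaPhi R) * expand 2 two_ne_zero (thetaPronic R) ^ 2)) := by
  have h1 := isExponent_sq.const_mul (m := 2) (by norm_num)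
  have h2 := isExponent_pronic.const_mul (m := 2) (by norm_num)
  have h3 := h1.add (h1.add h1)
  have h4 := (h1.add (h2.add h2)).add_const zero_le_one
  have h5 : ∀ a b : R⟦X⟧, a ^ 3 + 3 * (X * (a * b ^ 2)) =
      a * (a * a) + (X * (a * (b * b)) + (X * (a * (b * b)) + X * (a * (b * b)))) := by
    intro a b; ring
  have h6 : ∀ {ι κ : Type} {e : ι → ℤ} {e' : κ → ℤ}, IsExponent e → IsExponent e' →
      IsExponent (Sum.elim e e') := fun {ι κ e e'} h h' ↦
    ⟨by rintro (i | i) <;> simp [h.nonneg, h'.nonneg], fun n ↦ by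
      refine (((h.finite_le n).image Sum.inl).union ((h'.finite_le n).image Sum.inr)).subset ?_
      rintro (i | i) hi <;> simpa using hi⟩
  rw [h5, thetaPhi, thetaPronic, expand_qSeries, expand_qSeries, Nat.cast_ofNat,
    qSeries_mul h1 h1, qSeries_mul h1 (h1.add h1), qSeries_mul h2 h2, qSeries_mul h1 (h2.add h2),
    X_mul_qSeries (h1.add (h2.add h2)).nonneg, ← qSeries_sumElim h4 h4,
    ← qSeries_sumElim h4 (h6 h4 h4), ← qSeries_sumElim h3 (h6 h4 (h6 h4 h4)), thetaA3]
  have e0 : ∀ w u v, a3Equiv (.inl (w, u, v)) = (u + v - w, u - v + w, -u + v + w) :=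
    fun _ _ _ ↦ rfl
  have e1 : ∀ w u v, a3Equiv (.inr (.inl (w, u, v))) = (u + v - w + 1, u - v + w, -u + v + w) :=
    fun _ _ _ ↦ rfl
  have e2 : ∀ w u v, a3Equiv (.inr (.inr (.inl (w, u, v)))) =
      (u - v + w, -u + v + w, u + v - w + 1) := fun _ _ _ ↦ rfl
  have e3 : ∀ w u v, a3Equiv (.inr (.inr (.inr (w, u, v)))) =
      (u - v + w, u + v - w + 1, -u + v + w) := fun _ _ _ ↦ rfl
  refine (qSeries_equiv a3Equiv ?_ ?_).symm
  · rintro (⟨x, y, z⟩ | ⟨x, y, z⟩ | ⟨x, y, z⟩ | ⟨x, y, z⟩) <;>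
      simp only [e0, e1, e2, e3, Sum.elim_inl, Sum.elim_inr] <;> ring
  · rintro (x | x | x | x) <;> simp

end Theta

/-! ### The finite Jacobi triple product identity -/

section GaussBinom
variable {A B : Type*} [CommRing A] [CommRing B]

/-- The Gaussian binomial coefficient at an element `q` of a commutative ring, defined by the
`q`-Pascal recursion. -/
def gaussBinom (q : A) : ℕ → ℕ → A
  | _, 0 => 1
  | 0, _ + 1 => 0
  | n + 1, k + 1 => gaussBinom q n k + q ^ (k + 1) * gaussBinom q n (k + 1)

variable (q : A)

lemma gaussBinom_zero_right (n : ℕ) : gaussBinom q n 0 = 1 := by cases n <;> rfl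

lemma gaussBinom_succ_succ (n k : ℕ) :
    gaussBinom q (n + 1) (k + 1) = gaussBinom q n k + q ^ (k + 1) * gaussBinom q n (k + 1) := rfl

lemma gaussBinom_eq_zero_of_lt {n k : ℕ} (h : n < k) : gaussBinom q n k = 0 := by
  induction n generalizing k with
  | zero => obtain ⟨k, rfl⟩ := Nat.exists_eq_succ_of_ne_zero h.ne'; rfl
  | succ n ih =>
    obtain ⟨k, rfl⟩ := Nat.exists_eq_succ_of_ne_zero (Nat.ne_zero_of_lt h)
    rw [Nat.succ_eq_add_one, gaussBinom_succ_succ, ih (by omega), ih (by omega)]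
    ring

lemma map_gaussBinom (f : A →+* B) (n k : ℕ) :
    f (gaussBinom q n k) = gaussBinom (f q) n k := by
  induction n generalizing k with
  | zero => cases k <;> simp [gaussBinom]
  | succ n ih =>
    cases k with
    | zero => simp [gaussBinom]
    | succ k => simp [gaussBinom_succ_succ, ih]

/-- The finite product `(1 - q) (1 - q²) ⋯ (1 - qⁿ)`. -/
def qPoch (n : ℕ) : A := ∏ i ∈ Finset.range n, (1 - q ^ (i + 1))

lemma qPoch_succ (n : ℕ) : qPoch q (n + 1) = qPoch q n * (1 - q ^ (n + 1)) :=
  Finset.prod_range_succ _ _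

lemma gaussBinom_self (n : ℕ) : gaussBinom q n n = 1 := by
  induction n with
  | zero => rfl
  | succ n ih => rw [gaussBinom_succ_succ, ih, gaussBinom_eq_zero_of_lt q (by omega)]; ring

/-- The closed form of the Gaussian binomial coefficients, without division. -/
lemma gaussBinom_mul_qPoch (m k : ℕ) :
    gaussBinom q (m + k) k * (qPoch q k * qPoch q m) = qPoch q (m + k) := by
  induction k generalizing m with
  | zero => simp [gaussBinom_zero_right, qPoch]
  | succ k ihk =>
    induction m with
    | zero => simp [gaussBinom_self, qPoch]
    | succ m ihm =>
      have h1 := ihk (m + 1)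
      rw [show m + 1 + k = m + (k + 1) by ring] at h1
      rw [show m + 1 + (k + 1) = m + (k + 1) + 1 by ring, gaussBinom_succ_succ,
        qPoch_succ _ (m + (k + 1))]
      have h2 : gaussBinom q (m + (k + 1)) k * (qPoch q (k + 1) * qPoch q (m + 1)) =
          qPoch q (m + (k + 1)) * (1 - q ^ (k + 1)) := by
        rw [← h1, qPoch_succ _ k]; ring
      have h3 : gaussBinom q (m + (k + 1)) (k + 1) * (qPoch q (k + 1) * qPoch q (m + 1)) =
          qPoch q (m + (k + 1)) * (1 - q ^ (m + 1)) := by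
        rw [← ihm, qPoch_succ _ m]; ring
      rw [add_mul, h2, mul_assoc, h3]
      ring

variable {q}

lemma sum_gaussBinom_succ (q : A) (n : ℕ) (r : ℕ → A) :
    ∑ k ∈ Finset.range (n + 2), gaussBinom q (n + 1) k * r k =
      ∑ k ∈ Finset.range (n + 1), gaussBinom q n k * r (k + 1) +
        ∑ k ∈ Finset.range (n + 1), gaussBinom q n k * (q ^ k * r k) := by
  have h : ∑ k ∈ Finset.range (n + 1), gaussBinom q n k * (q ^ k * r k) =
      ∑ k ∈ Finset.range (n + 2), gaussBinom q n k * (q ^ k * r k) := by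
    rw [Finset.sum_range_succ _ (n + 1), gaussBinom_eq_zero_of_lt q (Nat.lt_succ_self n)]
    ring
  rw [h, Finset.sum_range_succ', Finset.sum_range_succ' _ (n + 1), ← add_assoc,
    ← Finset.sum_add_distrib]
  congr 1
  · refine Finset.sum_congr rfl fun k _ ↦ ?_
    rw [gaussBinom_succ_succ]
    ring
  · simp [gaussBinom_zero_right]

/-- The `q`-binomial theorem; here `u k = (-a) ^ k * q ^ (k * (k - 1) / 2)`. -/
lemma prod_one_sub_eq_sum_gaussBinom (q : A) (M : ℕ) {a : A} {u : ℕ → A} (h0 : u 0 = 1)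
    (hu : ∀ k, u (k + 1) = -a * q ^ k * u k) :
    ∏ i ∈ Finset.range M, (1 - a * q ^ i) =
      ∑ k ∈ Finset.range (M + 1), gaussBinom q M k * u k := by
  induction M generalizing a u with
  | zero => simp [gaussBinom_zero_right, h0]
  | succ M ih =>
    have h1 : ∏ i ∈ Finset.range M, (1 - a * q ^ (i + 1)) =
        ∑ k ∈ Finset.range (M + 1), gaussBinom q M k * (q ^ k * u k) := by
      rw [← ih (a := a * q) (u := fun k ↦ q ^ k * u k) (by simp [h0])
        (fun k ↦ by simp only [hu]; ring)]
      exact Finset.prod_congr rfl fun i _ ↦ by ring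
    rw [Finset.prod_range_succ', h1, sum_gaussBinom_succ, pow_zero, mul_one, mul_sub, mul_one,
      Finset.sum_mul, sub_eq_add_neg, ← Finset.sum_neg_distrib, add_comm]
    congr 1
    exact Finset.sum_congr rfl fun k _ ↦ by rw [hu]; ring

/-- The finite form of the Jacobi triple product identity. For `a = z * q` and `b = z⁻¹` the
hypotheses say that `t j = (-1) ^ j * z ^ j * q ^ (j * (j + 1) / 2)`. -/
theorem prod_mul_prod_eq_sum_gaussBinom {a b q : A} (hab : a * b = q) {t : ℤ → A} (h0 : t 0 = 1)
    (hpos : ∀ j : ℕ, t (j + 1) = -a * q ^ j * t j)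
    (hneg : ∀ j : ℕ, t (-j - 1) = -b * q ^ j * t (-j)) (M N : ℕ) :
    (∏ i ∈ Finset.range M, (1 - a * q ^ i)) * ∏ i ∈ Finset.range N, (1 - b * q ^ i) =
      ∑ k ∈ Finset.range (M + N + 1), gaussBinom q (M + N) k * t (k - N) := by
  induction N with
  | zero =>
    simpa using prod_one_sub_eq_sum_gaussBinom q M (u := fun k ↦ t k) (by simpa using h0)
      (fun k ↦ by exact_mod_cast hpos k)
  | succ N ih =>
    have key : ∀ k : ℕ, q ^ k * t (k - (N + 1 : ℕ)) = -b * q ^ N * t (k - N) := by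
      intro k
      rcases le_or_gt k N with h | h
      · obtain ⟨d, rfl⟩ := Nat.exists_eq_add_of_le h
        have := hneg d
        rw [show (k : ℤ) - (k + d + 1 : ℕ) = -d - 1 by push_cast; ring,
          show (k : ℤ) - (k + d : ℕ) = -d by push_cast; ring, this]
        ring
      · obtain ⟨d, rfl⟩ := Nat.exists_eq_add_of_lt h
        have := hpos d
        rw [show ((N + d + 1 : ℕ) : ℤ) - (N + 1 : ℕ) = d by push_cast; ring,
          show ((N + d + 1 : ℕ) : ℤ) - N = d + 1 by push_cast; ring, this, ← hab]
        ring
    rw [Finset.prod_range_succ, ← mul_assoc, ih, ← add_assoc, sum_gaussBinom_succ, mul_sub,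
      mul_one, sub_eq_add_neg, Finset.sum_mul, ← Finset.sum_neg_distrib]
    congr 1
    · refine Finset.sum_congr rfl fun k _ ↦ ?_
      congr 2
      push_cast
      ring
    · refine Finset.sum_congr rfl fun k _ ↦ ?_
      rw [key]
      ring

end GaussBinom

/-! ### Euler's product and the passage to the limit -/

section EulerProd
variable (R : Type*) [CommRing R]

/-- Euler's product `∏ (1 - X ^ n)` over `n ≥ 1`, as a power series: the coefficient at `n` is read
off from the first `n` factors, as the others do not affect it. -/
noncomputable def eulerProd : R⟦X⟧ := PowerSeries.mk fun n ↦ coeff n (qPoch (X : R⟦X⟧) n)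

lemma X_pow_dvd_qPoch_sub {n m : ℕ} (h : n ≤ m) :
    (X : R⟦X⟧) ^ (n + 1) ∣ qPoch X m - qPoch X n := by
  induction m, h using Nat.le_induction with
  | base => simp
  | succ m h ih =>
    rw [qPoch_succ, show qPoch (X : R⟦X⟧) m * (1 - X ^ (m + 1)) - qPoch X n =
      (qPoch X m - qPoch X n) - X ^ (m + 1) * qPoch X m by ring]
    exact dvd_sub ih (Dvd.dvd.mul_right (pow_dvd_pow _ (by omega)) _)

lemma X_pow_dvd_eulerProd_sub {n m : ℕ} (h : n ≤ m) :
    X ^ (n + 1) ∣ eulerProd R - qPoch X m := by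
  rw [X_pow_dvd_iff]
  intro i hi
  have := X_pow_dvd_iff.1 (X_pow_dvd_qPoch_sub R (show i ≤ m by omega)) i (by omega)
  rw [map_sub, sub_eq_zero] at this
  rw [map_sub, this, eulerProd, coeff_mk, sub_self]

lemma isUnit_eulerProd : IsUnit (eulerProd R) := by
  rw [isUnit_iff_constantCoeff, ← coeff_zero_eq_constantCoeff_apply, eulerProd, coeff_mk]
  simp [qPoch]

/-- The Gaussian binomial coefficients tend to `1 / eulerProd`. -/
lemma X_pow_dvd_eulerProd_mul_gaussBinom_sub {r m k : ℕ} (hm : r ≤ m) (hk : r ≤ k) :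
    X ^ (r + 1) ∣ eulerProd R * gaussBinom X (m + k) k - 1 := by
  rw [← (isUnit_eulerProd R).dvd_mul_left]
  have h := gaussBinom_mul_qPoch (X : R⟦X⟧) m k
  rw [show eulerProd R * (eulerProd R * gaussBinom X (m + k) k - 1) =
      (eulerProd R - qPoch X k) * (eulerProd R * gaussBinom X (m + k) k) +
      (eulerProd R - qPoch X m) * (qPoch X k * gaussBinom X (m + k) k) -
      (eulerProd R - qPoch X (m + k)) by rw [← h]; ring]
  exact dvd_sub (dvd_add (Dvd.dvd.mul_right (X_pow_dvd_eulerProd_sub R hk) _)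
    (Dvd.dvd.mul_right (X_pow_dvd_eulerProd_sub R hm) _)) (X_pow_dvd_eulerProd_sub R (by omega))

/-- A series over `ℤ` is approximated by finite sums whose terms carry factors close to `1`, if the
exponents grow so fast that they make up for the poor precision of the outer factors. -/
lemma X_pow_dvd_qSeries_sub_sum_mul {e : ℤ → ℤ} (he : ∀ j, |j| ≤ e j + 1)
    (he0 : ∀ j, 0 ≤ e j) (w : ℤ → R) {M N : ℕ} {g : ℕ → R⟦X⟧}
    (hg : ∀ m k, m + k = M + N → X ^ (min m k + 1) ∣ g k - 1) :
    X ^ min M N ∣ qSeries e w - ∑ k ∈ Finset.range (M + N + 1),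
      g k * (C (w (k - N)) * X ^ (e (k - N)).toNat) := by
  have h1 := X_pow_dvd_qSeries_sub_sum he0 w (min M N)
    ((Finset.range (M + N + 1)).map ⟨fun k : ℕ ↦ (k : ℤ) - N, fun a b h ↦ by simpa using h⟩) <| by
      intro j hj
      have := abs_le.1 (he j)
      refine Finset.mem_map.2 ⟨(j + N).toNat, Finset.mem_range.2 (by omega), ?_⟩
      change (((j + N).toNat : ℕ) : ℤ) - N = j
      omega
  rw [Finset.sum_map] at h1
  change X ^ min M N ∣ qSeries e w - ∑ k ∈ Finset.range (M + N + 1),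
    C (w (k - N)) * X ^ (e (k - N)).toNat at h1
  have h2 : X ^ min M N ∣ (∑ k ∈ Finset.range (M + N + 1),
      g k * (C (w (k - N)) * X ^ (e (k - N)).toNat)) -
      ∑ k ∈ Finset.range (M + N + 1), C (w (k - N)) * X ^ (e (k - N)).toNat := by
    rw [← Finset.sum_sub_distrib]
    refine Finset.dvd_sum fun k hk ↦ ?_
    rw [show ∀ a c d : R⟦X⟧, a * (c * d) - c * d = c * (d * (a - 1)) by intros; ring]
    refine Dvd.dvd.mul_left ?_ _
    obtain ⟨m, hm⟩ := Nat.exists_eq_add_of_le' (Nat.lt_succ_iff.1 (Finset.mem_range.1 hk))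
    refine dvd_trans ?_ (mul_dvd_mul_left _ (hg m k hm.symm))
    rw [← pow_add]
    have h3 := abs_le.1 (he (k - N))
    have h4 := he0 (k - N)
    exact pow_dvd_pow _ (by omega)
  have := dvd_sub h1 h2
  rwa [sub_sub_sub_cancel_right] at this

/-- The series obtained from the finite Jacobi triple product identity as both ranges grow. -/
lemma X_pow_dvd_qSeries_sub_eulerProd_mul_sum {e : ℤ → ℤ} (he : ∀ j, |j| ≤ e j + 1)
    (he0 : ∀ j, 0 ≤ e j) (w : ℤ → R) (M N : ℕ) :
    X ^ min M N ∣ qSeries e w - eulerProd R * ∑ k ∈ Finset.range (M + N + 1),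
      gaussBinom X (M + N) k * (C (w (k - N)) * X ^ (e (k - N)).toNat) := by
  simp only [Finset.mul_sum, ← mul_assoc (eulerProd R)]
  refine X_pow_dvd_qSeries_sub_sum_mul R he he0 w fun m k h ↦ ?_
  rw [← h]
  exact X_pow_dvd_eulerProd_mul_gaussBinom_sub R (min_le_left m k) (min_le_right m k)

end EulerProd

section Triangular

/-- The triangular numbers, for an index of either sign. -/
def tri (j : ℤ) : ℤ := j * (j + 1) / 2

lemma two_mul_tri (j : ℤ) : 2 * tri j = j * (j + 1) :=
  Int.mul_ediv_cancel' (Int.even_mul_succ_self j).two_dvd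

lemma tri_nonneg (j : ℤ) : 0 ≤ tri j := by
  have := two_mul_tri j
  have := Int.mul_add_one_nonneg j
  omega

lemma abs_le_tri (j : ℤ) : |j| ≤ tri j + 1 := by
  have := two_mul_tri j
  rcases abs_cases j with h | h <;> rw [h.1]
  · nlinarith [sq_nonneg (j - 1)]
  · nlinarith [sq_nonneg (j + 2), sq_nonneg (j + 1)]

lemma isExponent_tri : IsExponent tri := isExponent_of_abs_le abs_le_tri tri_nonneg

lemma tri_add_one (j : ℤ) : tri (j + 1) = tri j + (j + 1) := by
  have h1 := two_mul_tri j
  have h2 := two_mul_tri (j + 1)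
  linarith

lemma tri_neg_sub_one (j : ℤ) : tri (-j - 1) = tri (-j) + j := by
  have h1 := two_mul_tri (-j)
  have h2 := two_mul_tri (-j - 1)
  linarith

lemma toNat_tri_add_one (j : ℕ) : (tri (j + 1)).toNat = (tri j).toNat + (j + 1) := by
  have := tri_add_one j
  have := tri_nonneg j
  omega

lemma toNat_tri_neg_sub_one (j : ℕ) : (tri (-j - 1)).toNat = (tri (-j)).toNat + j := by
  have := tri_neg_sub_one j
  have := tri_nonneg (-j)
  omega

lemma natAbs_neg_sub_one (j : ℕ) : (-(j : ℤ) - 1).natAbs = j + 1 := by omega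

end Triangular

/-! ### Jacobi's identity and Gauss's product formula -/

section Jacobi
variable (R : Type*) [CommRing R]

/-- The Jacobi triple product identity differentiated at `z = 1`. -/
lemma qPoch_sq_eq_sum (N : ℕ) : qPoch (X : R⟦X⟧) N ^ 2 =
    ∑ k ∈ Finset.range (N + (N + 1) + 1), gaussBinom X (N + (N + 1)) k *
      (C (R := R) ((-1) ^ ((k : ℤ) - (N + 1 : ℕ)).natAbs * (((k : ℤ) - (N + 1 : ℕ) : ℤ) : R)) *
        X ^ (tri ((k : ℤ) - (N + 1 : ℕ))).toNat) := by
  let u : ℤ → R⟦X⟧ := fun j ↦ (-1) ^ j.natAbs * X ^ (tri j).toNat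
  -- `t j` is the value of `(-1) ^ j * z ^ j * X ^ tri j` at `z = 1 + ε`
  let t : ℤ → DualNumber R⟦X⟧ := fun j ↦ .inl (u j) + .inr ((j : R⟦X⟧) * u j)
  have key := prod_mul_prod_eq_sum_gaussBinom (A := DualNumber R⟦X⟧) (q := .inl X)
    (a := .inl X + .inr X) (b := .inl 1 - .inr 1) (t := t) ?_ ?_ ?_ ?_ N (N + 1)
  · have h1 := congrArg TrivSqZeroExt.snd key
    have h2 : ∀ i, 1 - (TrivSqZeroExt.inl 1 - TrivSqZeroExt.inr 1 : DualNumber R⟦X⟧) * .inl X ^ i =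
        .inl (1 - X ^ i) + .inr (X ^ i) := by
      intro i; apply TrivSqZeroExt.ext <;> simp [← TrivSqZeroExt.inl_pow]
    have h3 : ∀ i, 1 - (TrivSqZeroExt.inl X + TrivSqZeroExt.inr X : DualNumber R⟦X⟧) * .inl X ^ i =
        .inl (1 - X ^ (i + 1)) - .inr (X ^ (i + 1)) := by
      intro i; apply TrivSqZeroExt.ext <;> simp [← TrivSqZeroExt.inl_pow, pow_succ']
    have h4 : ∀ (s : Finset ℕ) (f : ℕ → DualNumber R⟦X⟧),
        (∏ i ∈ s, f i).fst = ∏ i ∈ s, (f i).fst :=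
      fun s f ↦ map_prod (TrivSqZeroExt.fstHom R R⟦X⟧ R⟦X⟧) f s
    have h5 : ∀ n k, gaussBinom (.inl X : DualNumber R⟦X⟧) n k = .inl (gaussBinom X n k) :=
      fun n k ↦ (map_gaussBinom X (TrivSqZeroExt.inlHom R⟦X⟧ R⟦X⟧) n k).symm
    simp only [Finset.prod_range_succ', h2, h3, h5, pow_zero, sub_self, TrivSqZeroExt.inl_zero,
      zero_add, ← mul_assoc] at h1
    rw [TrivSqZeroExt.snd_mul, TrivSqZeroExt.snd_sum] at h1
    simp only [TrivSqZeroExt.fst_mul, h4, TrivSqZeroExt.snd_inr, TrivSqZeroExt.fst_inr,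
      TrivSqZeroExt.fst_add, TrivSqZeroExt.fst_sub, TrivSqZeroExt.fst_inl, sub_zero, add_zero,
      smul_eq_mul, mul_one, MulOpposite.op_zero, zero_smul, TrivSqZeroExt.snd_mul, t,
      TrivSqZeroExt.snd_inl, TrivSqZeroExt.snd_add, smul_zero, zero_add] at h1
    rw [sq, qPoch, h1]
    refine Finset.sum_congr rfl fun k _ ↦ ?_
    simp only [u, map_mul, map_pow, map_neg, map_one, map_intCast]
    ring
  · apply TrivSqZeroExt.ext <;> simp
  · apply TrivSqZeroExt.ext <;> simp [t, u, tri]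
  · intro j
    have h : ((j : ℤ) + 1).natAbs = j + 1 := by omega
    apply TrivSqZeroExt.ext <;> simp [t, u, toNat_tri_add_one, h, ← TrivSqZeroExt.inl_pow] <;> ring
  · intro j
    apply TrivSqZeroExt.ext <;>
      simp [t, u, toNat_tri_neg_sub_one, natAbs_neg_sub_one, ← TrivSqZeroExt.inl_pow] <;> ring

lemma eulerProd_pow_three_eq_qSeries :
    eulerProd R ^ 3 = qSeries tri (fun j ↦ (-1) ^ j.natAbs * (j : R)) := by
  refine eq_of_forall_X_pow_dvd_sub fun N ↦ ?_
  have h1 := X_pow_dvd_qSeries_sub_eulerProd_mul_sum R abs_le_tri tri_nonneg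
    (fun j ↦ (-1) ^ j.natAbs * (j : R)) N (N + 1)
  rw [← qPoch_sq_eq_sum, min_eq_left (Nat.le_succ N)] at h1
  have h2 : (X : R⟦X⟧) ^ N ∣ eulerProd R - qPoch X N :=
    (pow_dvd_pow _ (Nat.le_succ N)).trans (X_pow_dvd_eulerProd_sub R le_rfl)
  rw [show eulerProd R ^ 3 - qSeries tri (fun j ↦ (-1) ^ j.natAbs * (j : R)) =
    (eulerProd R - qPoch X N) * (eulerProd R * (eulerProd R + qPoch X N)) -
    (qSeries tri (fun j ↦ (-1) ^ j.natAbs * (j : R)) - eulerProd R * qPoch X N ^ 2) by ring]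
  exact dvd_sub (Dvd.dvd.mul_right h2 _) h1

/-- Jacobi's identity for the cube of Euler's product, with every term counted twice: the indices
`j` and `-1 - j` contribute the same term. -/
theorem two_mul_eulerProd_pow_three : 2 * eulerProd R ^ 3 =
    qSeries tri (fun j ↦ (-1) ^ j.natAbs * ((2 * j + 1 : ℤ) : R)) := by
  have h : qSeries tri (fun j ↦ (-1) ^ j.natAbs * (j : R)) =
      qSeries tri (fun j ↦ (-1) ^ j.natAbs * ((j + 1 : ℤ) : R)) := by
    refine qSeries_equiv (Equiv.subLeft (-1)) (fun j ↦ ?_) (fun j ↦ ?_)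
    · rw [Equiv.subLeft_apply, ← mul_right_inj' (two_ne_zero (α := ℤ)), two_mul_tri, two_mul_tri]
      ring
    · rw [Equiv.subLeft_apply]
      rcases le_or_gt 0 j with hj | hj
      · rw [show (-1 - j).natAbs = j.natAbs + 1 by omega]
        push_cast; ring
      · rw [show j.natAbs = (-1 - j).natAbs + 1 by omega]
        push_cast; ring
  rw [two_mul, eulerProd_pow_three_eq_qSeries]
  nth_rewrite 2 [h]
  rw [qSeries_add isExponent_tri]
  congr 1
  ext j
  push_cast
  ring

lemma qPoch_two_mul (N : ℕ) : qPoch (X : R⟦X⟧) (2 * N) =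
    (∏ i ∈ Finset.range N, (1 - X * (X ^ 2) ^ i)) * qPoch (X ^ 2) N := by
  induction N with
  | zero => simp [qPoch]
  | succ N ih =>
    rw [show 2 * (N + 1) = 2 * N + 1 + 1 by ring, qPoch_succ, qPoch_succ, ih, qPoch_succ,
      Finset.prod_range_succ, ← pow_mul, ← pow_mul, ← pow_succ']
    ring_nf

lemma toNat_sq (j : ℤ) : (j ^ 2).toNat = j.natAbs ^ 2 := by
  have : ((j.natAbs ^ 2 : ℕ) : ℤ) = j ^ 2 := by push_cast; exact sq_abs j
  omega

lemma evalNegHom_thetaPhi :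
    evalNegHom (thetaPhi R) = qSeries (fun j : ℤ ↦ j ^ 2) (fun j ↦ (-1) ^ j.natAbs) := by
  rw [thetaPhi, evalNegHom_qSeries isExponent_sq]
  congr 1
  ext j
  rw [Pi.one_apply, mul_one, neg_one_pow_eq_pow_mod_two, neg_one_pow_eq_pow_mod_two (n := j.natAbs)]
  congr 1
  rw [toNat_sq, Nat.pow_mod]
  rcases Nat.mod_two_eq_zero_or_one j.natAbs with h | h <;> simp [h]

lemma expand_gaussBinom (n k : ℕ) :
    expand 2 two_ne_zero (gaussBinom (X : R⟦X⟧) n k) = gaussBinom (X ^ 2) n k := by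
  rw [← expand_X (R := R) 2 two_ne_zero]
  exact map_gaussBinom X (expand (R := R) 2 two_ne_zero).toRingHom n k

lemma X_pow_dvd_expand {g : R⟦X⟧} {N : ℕ} (h : X ^ N ∣ g) :
    X ^ N ∣ expand 2 two_ne_zero g := by
  obtain ⟨g, rfl⟩ := h
  rw [map_mul, map_pow, expand_X, ← pow_mul]
  exact Dvd.dvd.mul_right (pow_dvd_pow _ (by omega)) _

lemma expand_qPoch (n : ℕ) :
    expand 2 two_ne_zero (qPoch (X : R⟦X⟧) n) = qPoch (X ^ 2) n := by
  simp [qPoch]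

/-- Gauss's product formula `φ(-X) = ∏ (1 - X ^ n) ^ 2 / ∏ (1 - X ^ (2 * n))`, from the triple product
with `q = X ^ 2` and `a = b = X`. -/
theorem evalNegHom_thetaPhi_mul_expand_eulerProd :
    evalNegHom (thetaPhi R) * expand 2 two_ne_zero (eulerProd R) = eulerProd R ^ 2 := by
  refine eq_of_forall_X_pow_dvd_sub fun N ↦ ?_
  set E := eulerProd R
  set E₂ := expand 2 two_ne_zero E
  set O : R⟦X⟧ := ∏ i ∈ Finset.range N, (1 - X * (X ^ 2) ^ i)
  have hO : O * O = ∑ k ∈ Finset.range (N + N + 1), gaussBinom (X ^ 2) (N + N) k *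
      ((-1) ^ ((k : ℤ) - N).natAbs * X ^ (((k : ℤ) - N).natAbs ^ 2)) := by
    refine prod_mul_prod_eq_sum_gaussBinom (t := fun j ↦ (-1) ^ j.natAbs * X ^ (j.natAbs ^ 2))
      (sq X).symm (by simp) (fun j ↦ ?_) (fun j ↦ ?_) N N
    · rw [show ((j : ℤ) + 1).natAbs = j + 1 by omega, Int.natAbs_natCast]
      ring
    · rw [natAbs_neg_sub_one, Int.natAbs_neg, Int.natAbs_natCast]
      ring
  have h1 : X ^ N ∣ evalNegHom (thetaPhi R) - E₂ * (O * O) := by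
    rw [evalNegHom_thetaPhi, hO, Finset.mul_sum]
    have h := X_pow_dvd_qSeries_sub_sum_mul R abs_le_sq (fun j ↦ sq_nonneg j)
      (fun j ↦ (-1) ^ j.natAbs) (M := N) (N := N) (g := fun k ↦ E₂ * gaussBinom (X ^ 2) (N + N) k)
      fun m k h ↦ ?_
    · simpa only [min_self, mul_assoc, map_pow, map_neg, map_one, toNat_sq] using h
    · rw [← h, ← expand_gaussBinom, ← map_mul, ← map_one (expand 2 two_ne_zero), ← map_sub]
      exact X_pow_dvd_expand R
        (X_pow_dvd_eulerProd_mul_gaussBinom_sub R (min_le_left m k) (min_le_right m k))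
  have h2 : (X : R⟦X⟧) ^ N ∣ E₂ - qPoch (X ^ 2) N := by
    rw [← expand_qPoch, ← map_sub]
    exact X_pow_dvd_expand R
      ((pow_dvd_pow _ (Nat.le_succ N)).trans (X_pow_dvd_eulerProd_sub R le_rfl))
  have h3 : (X : R⟦X⟧) ^ N ∣ E - O * qPoch (X ^ 2) N := by
    rw [← qPoch_two_mul]
    exact (pow_dvd_pow _ (Nat.le_succ N)).trans (X_pow_dvd_eulerProd_sub R (by omega))
  rw [show evalNegHom (thetaPhi R) * E₂ - E ^ 2 =
    (evalNegHom (thetaPhi R) - E₂ * (O * O)) * E₂ +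
    (E₂ - qPoch (X ^ 2) N) * (O * O * (E₂ + qPoch (X ^ 2) N)) -
    (E - O * qPoch (X ^ 2) N) * (E + O * qPoch (X ^ 2) N) by ring]
  exact dvd_sub (dvd_add (Dvd.dvd.mul_right h1 _) (Dvd.dvd.mul_right h2 _))
    (Dvd.dvd.mul_right h3 _)

end Jacobi

/-! ### The constant term of the fourth power of the triple product -/

section ConstantTerm
variable (R : Type*) [CommRing R]

open LaurentPolynomial (T)

/-- The finite product `∏ (1 - T * X ^ (i + 1)) * (1 - T⁻¹ * X ^ i)` over `i < N`. -/
noncomputable def tripleProd (N : ℕ) : LaurentPolynomial R⟦X⟧ :=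
  (∏ i ∈ Finset.range N, (1 - LaurentPolynomial.C (X ^ (i + 1)) * T 1)) *
    ∏ i ∈ Finset.range N, (1 - LaurentPolynomial.C (X ^ i) * T (-1))

/-- The indices `-N, …, N`. -/
def symmIndices (N : ℕ) : Finset ℤ :=
  (Finset.range (N + N + 1)).map ⟨fun k : ℕ ↦ (k : ℤ) - N, fun a b h ↦ by simpa using h⟩

lemma mem_symmIndices {N : ℕ} {j : ℤ} : j ∈ symmIndices N ↔ |j| ≤ N := by
  rw [abs_le, symmIndices, Finset.mem_map]
  constructor
  · rintro ⟨k, hk, rfl⟩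
    have := Finset.mem_range.1 hk
    change -(N : ℤ) ≤ (k : ℤ) - N ∧ (k : ℤ) - N ≤ N
    omega
  · intro h
    refine ⟨(j + N).toNat, Finset.mem_range.2 (by omega), ?_⟩
    change (((j + N).toNat : ℕ) : ℤ) - N = j
    omega

/-- The theta function `∑ (-1) ^ j * X ^ tri j * T ^ j`, cut off at `|j| ≤ N`. -/
noncomputable def partialTheta (N : ℕ) : LaurentPolynomial R⟦X⟧ :=
  ∑ j ∈ symmIndices N, LaurentPolynomial.C ((-1) ^ j.natAbs * X ^ (tri j).toNat) * T j

lemma tripleProd_eq_sum (N : ℕ) : tripleProd R N = ∑ k ∈ Finset.range (N + N + 1),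
    LaurentPolynomial.C (gaussBinom X (N + N) k) *
      (LaurentPolynomial.C ((-1) ^ ((k : ℤ) - N).natAbs * X ^ (tri (k - N)).toNat) * T (k - N)) := by
  simp only [map_gaussBinom]
  rw [← prod_mul_prod_eq_sum_gaussBinom (q := LaurentPolynomial.C X)
    (a := LaurentPolynomial.C (X : R⟦X⟧) * T 1) (b := T (-1))
    (t := fun j ↦ LaurentPolynomial.C ((-1) ^ j.natAbs * X ^ (tri j).toNat) * T j)]
  · rw [tripleProd]
    refine congrArg₂ (· * ·) (Finset.prod_congr rfl fun i _ ↦ ?_)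
      (Finset.prod_congr rfl fun i _ ↦ ?_)
    · rw [pow_succ, map_mul, map_pow]; ring
    · rw [map_pow]; ring
  · rw [mul_assoc, ← LaurentPolynomial.T_add]; simp
  · simp [tri]
  · intro j
    rw [toNat_tri_add_one, show ((j : ℤ) + 1).natAbs = j + 1 by omega, Int.natAbs_natCast,
      LaurentPolynomial.T_add]
    simp only [map_mul, map_pow, map_neg, map_one]
    ring
  · intro j
    rw [toNat_tri_neg_sub_one, natAbs_neg_sub_one, Int.natAbs_neg, Int.natAbs_natCast,
      sub_eq_add_neg, LaurentPolynomial.T_add]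
    simp only [map_mul, map_pow, map_neg, map_one]
    ring

/-- The Jacobi triple product identity, modulo `X ^ N`. -/
lemma C_X_pow_dvd_eulerProd_mul_tripleProd_sub (N : ℕ) :
    LaurentPolynomial.C (X ^ N) ∣
      LaurentPolynomial.C (eulerProd R) * tripleProd R N - partialTheta R N := by
  rw [partialTheta, symmIndices, Finset.sum_map, tripleProd_eq_sum, Finset.mul_sum,
    ← Finset.sum_sub_distrib]
  refine Finset.dvd_sum fun k hk ↦ ?_
  obtain ⟨m, hm⟩ := Nat.exists_eq_add_of_le' (Nat.lt_succ_iff.1 (Finset.mem_range.1 hk))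
  change _ ∣ _ - LaurentPolynomial.C ((-1) ^ ((k : ℤ) - N).natAbs * X ^ (tri (k - N)).toNat) *
    T ((k : ℤ) - N)
  have h : (X : R⟦X⟧) ^ N ∣ eulerProd R * gaussBinom X (N + N) k *
      ((-1) ^ ((k : ℤ) - N).natAbs * X ^ (tri (k - N)).toNat) -
      (-1) ^ ((k : ℤ) - N).natAbs * X ^ (tri (k - N)).toNat := by
    rw [show ∀ a c d : R⟦X⟧, a * (c * d) - c * d = c * (d * (a - 1)) by intros; ring]
    refine Dvd.dvd.mul_left ?_ _
    rw [hm]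
    refine dvd_trans ?_ (mul_dvd_mul_left _ (X_pow_dvd_eulerProd_mul_gaussBinom_sub R
      (min_le_left m k) (min_le_right m k)))
    rw [← pow_add]
    have h3 := abs_le.1 (abs_le_tri (k - N))
    have h4 := tri_nonneg (k - N)
    exact pow_dvd_pow _ (by omega)
  generalize (-1 : R⟦X⟧) ^ ((k : ℤ) - N).natAbs * X ^ (tri (k - N)).toNat = v at h ⊢
  have h' := map_dvd LaurentPolynomial.C h
  rw [map_sub, map_mul, map_mul] at h'
  exact h'.trans ⟨T ((k : ℤ) - N), by ring⟩

/-- The constant term of a Laurent polynomial. -/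
noncomputable def constTerm {A : Type*} [CommRing A] : LaurentPolynomial A →ₗ[A] A where
  toFun f := f.coeff 0
  map_add' f g := by simp
  map_smul' a f := by simp

lemma constTerm_C_mul {A : Type*} [CommRing A] (a : A) (f : LaurentPolynomial A) :
    constTerm (LaurentPolynomial.C a * f) = a * constTerm f := by
  rw [← LaurentPolynomial.smul_eq_C_mul, map_smul, smul_eq_mul]

lemma constTerm_T {A : Type*} [CommRing A] (j : ℤ) :
    constTerm (T j : LaurentPolynomial A) = if j = 0 then 1 else 0 := by
  exact LaurentPolynomial.T_apply 0 j

lemma dvd_constTerm {A : Type*} [CommRing A] {a : A} {f : LaurentPolynomial A}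
    (h : LaurentPolynomial.C a ∣ f) : a ∣ constTerm f := by
  obtain ⟨g, rfl⟩ := h
  rw [constTerm_C_mul]
  exact Dvd.intro _ rfl

lemma constTerm_sum_pow_four {A : Type*} [CommRing A] (I : Finset ℤ) (u : ℤ → A) :
    constTerm ((∑ j ∈ I, LaurentPolynomial.C (u j) * T j) ^ 4) =
      ∑ p ∈ (I ×ˢ I ×ˢ I).filter fun p ↦ -(p.1 + p.2.1 + p.2.2) ∈ I,
        u p.1 * u p.2.1 * u p.2.2 * u (-(p.1 + p.2.1 + p.2.2)) := by
  have h : (∑ j ∈ I, LaurentPolynomial.C (u j) * T j) ^ 4 =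
      ∑ a ∈ I, ∑ b ∈ I, ∑ c ∈ I, ∑ d ∈ I,
        LaurentPolynomial.C (u a * u b * u c * u d) * T (a + b + c + d) := by
    rw [show ∀ S : LaurentPolynomial A, S ^ 4 = S * (S * (S * S)) by intro S; ring]
    rw [Finset.sum_mul_sum, Finset.sum_mul_sum, Finset.sum_mul_sum]
    simp only [Finset.mul_sum, LaurentPolynomial.T_add, map_mul]
    refine Finset.sum_congr rfl fun a _ ↦ Finset.sum_congr rfl fun b _ ↦
      Finset.sum_congr rfl fun c _ ↦ Finset.sum_congr rfl fun d _ ↦ by ring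
  rw [h, Finset.sum_filter, Finset.sum_product]
  simp only [Finset.sum_product, map_sum, constTerm_C_mul, constTerm_T]
  refine Finset.sum_congr rfl fun a _ ↦ Finset.sum_congr rfl fun b _ ↦
    Finset.sum_congr rfl fun c _ ↦ ?_
  have h1 : ∀ d, a + b + c + d = 0 ↔ -(a + b + c) = d := fun d ↦ by omega
  simp only [h1, mul_ite, mul_one, mul_zero, Finset.sum_ite_eq]

lemma tri_add_tri_add_tri_add_tri (a b c : ℤ) : tri a + tri b + tri c + tri (-(a + b + c)) =
    a ^ 2 + b ^ 2 + c ^ 2 + a * b + a * c + b * c := by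
  have h1 := two_mul_tri a
  have h2 := two_mul_tri b
  have h3 := two_mul_tri c
  have h4 := two_mul_tri (-(a + b + c))
  linarith

lemma X_pow_dvd_thetaA3_sub_constTerm (N : ℕ) :
    X ^ N ∣ thetaA3 R - constTerm (partialTheta R N ^ 4) := by
  rw [partialTheta, constTerm_sum_pow_four, thetaA3]
  have h0 : ∀ p : ℤ × ℤ × ℤ,
      0 ≤ p.1 ^ 2 + p.2.1 ^ 2 + p.2.2 ^ 2 + p.1 * p.2.1 + p.1 * p.2.2 + p.2.1 * p.2.2 := by
    rintro ⟨a, b, c⟩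
    have := tri_add_tri_add_tri_add_tri a b c
    have := tri_nonneg a
    have := tri_nonneg b
    have := tri_nonneg c
    have := tri_nonneg (-(a + b + c))
    simp only
    linarith
  convert X_pow_dvd_qSeries_sub_sum (R := R) h0 1 N (((symmIndices N) ×ˢ (symmIndices N) ×ˢ
    (symmIndices N)).filter fun p ↦ -(p.1 + p.2.1 + p.2.2) ∈ symmIndices N) ?_ using 3 with p hp
  · obtain ⟨a, b, c⟩ := p
    simp only
    have h1 := tri_nonneg a
    have h2 := tri_nonneg b
    have h3 := tri_nonneg c
    have h4 := tri_nonneg (-(a + b + c))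
    rw [← tri_add_tri_add_tri_add_tri, Int.toNat_add (by positivity) h4,
      Int.toNat_add (by positivity) h3, Int.toNat_add h1 h2, Pi.one_apply, map_one, one_mul]
    have h5 : (-1 : R⟦X⟧) ^ (a.natAbs + b.natAbs + c.natAbs + (-(a + b + c)).natAbs) = 1 :=
      Even.neg_one_pow (Nat.even_iff.2 (by omega))
    calc _ = (-1 : R⟦X⟧) ^ (a.natAbs + b.natAbs + c.natAbs + (-(a + b + c)).natAbs) *
        X ^ ((tri a).toNat + (tri b).toNat + (tri c).toNat + (tri (-(a + b + c))).toNat) := by ring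
      _ = _ := by rw [h5, one_mul]
  · rintro ⟨a, b, c⟩ h
    simp only at h
    rw [← tri_add_tri_add_tri_add_tri] at h
    have h1 := tri_nonneg a
    have h2 := tri_nonneg b
    have h3 := tri_nonneg c
    have h4 := tri_nonneg (-(a + b + c))
    have h1' := abs_le_tri a
    have h2' := abs_le_tri b
    have h3' := abs_le_tri c
    have h4' := abs_le_tri (-(a + b + c))
    simp only [Finset.mem_filter, Finset.mem_product, mem_symmIndices]
    refine ⟨⟨?_, ?_, ?_⟩, ?_⟩ <;> linarith

/-- Up to Euler's product, the constant term of the fourth power of Jacobi's triple product is the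
theta series of `A₃`. -/
lemma X_pow_dvd_thetaA3_sub_eulerProd_pow_four_mul (N : ℕ) :
    X ^ N ∣ thetaA3 R - eulerProd R ^ 4 * constTerm (tripleProd R N ^ 4) := by
  have h1 := dvd_constTerm ((C_X_pow_dvd_eulerProd_mul_tripleProd_sub R N).trans
    (sub_dvd_pow_sub_pow _ _ 4))
  rw [map_sub, mul_pow, ← map_pow, constTerm_C_mul] at h1
  have := dvd_sub (X_pow_dvd_thetaA3_sub_constTerm R N) h1
  rwa [sub_sub_sub_cancel_right] at this

end ConstantTerm

/-! ### Counting generalized Frobenius partitions -/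

section Counting

/-- The multiset in which `i < N` occurs `p i` times. -/
def multisetOfCounts {N : ℕ} (p : Fin N → ℕ) : Multiset ℕ :=
  ∑ i, Multiset.replicate (p i) (i : ℕ)

variable {N : ℕ} (p : Fin N → ℕ)

lemma count_multisetOfCounts (a : ℕ) :
    (multisetOfCounts p).count a = if h : a < N then p ⟨a, h⟩ else 0 := by
  rw [multisetOfCounts, Multiset.count_sum']
  simp only [Multiset.count_replicate]
  split_ifs with h
  · rw [Finset.sum_eq_single ⟨a, h⟩] <;> simp +contextual [Fin.ext_iff]
  · refine Finset.sum_eq_zero fun i _ ↦ if_neg ?_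
    omega

lemma card_multisetOfCounts : (multisetOfCounts p).card = ∑ i, p i := by
  simp [multisetOfCounts]

lemma sum_multisetOfCounts : (multisetOfCounts p).sum = ∑ i, i * p i := by
  simp [multisetOfCounts, Multiset.sum_sum, mul_comm]

lemma multisetOfCounts_injective : Function.Injective (multisetOfCounts (N := N)) := by
  intro p p' h
  ext i
  simpa [count_multisetOfCounts] using congrArg (Multiset.count (i : ℕ)) h

lemma multisetOfCounts_count {s : Multiset ℕ} (hs : ∀ a ∈ s, a < N) :
    multisetOfCounts (fun i : Fin N ↦ s.count (i : ℕ)) = s := by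
  ext a
  rw [count_multisetOfCounts]
  split_ifs with h
  · rfl
  · exact (Multiset.count_eq_zero_of_notMem fun ha ↦ h (hs a ha)).symm

/-- A generalized Frobenius partition of `n < N` is recorded by the multiplicities of `0, …, N - 1`
in its two rows. -/
lemma frobeniusPhi_eq_card (k : ℕ) {n : ℕ} (hn : n < N) : frobeniusPhi k n =
    ((Fintype.piFinset (fun _ : Fin N ↦ Finset.range (k + 1)) ×ˢ
      Fintype.piFinset (fun _ : Fin N ↦ Finset.range (k + 1))).filter fun p ↦
        ∑ i, p.1 i = ∑ i, p.2 i ∧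
          ∑ i : Fin N, ((i : ℕ) + 1) * p.1 i + ∑ i : Fin N, (i : ℕ) * p.2 i = n).card := by
  rw [frobeniusPhi, ← Set.ncard_coe_finset, ← Set.ncard_image_of_injective _
    (multisetOfCounts_injective.prodMap multisetOfCounts_injective)]
  congr 1
  ext ⟨s, t⟩
  have hcount : ∀ p : Fin N → ℕ, (∀ a, (multisetOfCounts p).count a ≤ k) ↔ ∀ i, p i ≤ k := by
    intro p
    refine ⟨fun h i ↦ by simpa [count_multisetOfCounts] using h i, fun h a ↦ ?_⟩
    rw [count_multisetOfCounts]
    split_ifs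
    exacts [h _, Nat.zero_le _]
  have hsum : ∀ p : Fin N → ℕ, ∑ i : Fin N, ((i : ℕ) + 1) * p i =
      (multisetOfCounts p).card + (multisetOfCounts p).sum := by
    intro p
    rw [card_multisetOfCounts, sum_multisetOfCounts, ← Finset.sum_add_distrib]
    exact Finset.sum_congr rfl fun i _ ↦ by ring
  constructor
  · rintro ⟨h1, h2, h3, h4⟩
    simp only at h1 h2 h3 h4
    have hs : ∀ a ∈ s, a < N := fun a ha ↦ by have := Multiset.le_sum_of_mem ha; omega
    have ht : ∀ a ∈ t, a < N := fun a ha ↦ by have := Multiset.le_sum_of_mem ha; omega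
    refine ⟨(fun i ↦ s.count (i : ℕ), fun i ↦ t.count (i : ℕ)), ?_, ?_⟩
    · simp only [Finset.coe_filter, Finset.mem_product, Fintype.mem_piFinset, Finset.mem_range,
        Set.mem_ofPred_eq, hsum, ← sum_multisetOfCounts]
      simp only [← card_multisetOfCounts, multisetOfCounts_count hs, multisetOfCounts_count ht]
      exact ⟨⟨fun i ↦ Nat.lt_succ_of_le (h2 i), fun i ↦ Nat.lt_succ_of_le (h3 i)⟩, h1, h4⟩
    · simp [multisetOfCounts_count hs, multisetOfCounts_count ht]
  · rintro ⟨⟨p, p'⟩, h, he⟩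
    simp only [Prod.map_apply, Prod.mk.injEq] at he
    obtain ⟨rfl, rfl⟩ := he
    simp only [Finset.coe_filter, Finset.mem_product, Fintype.mem_piFinset, Finset.mem_range,
        Set.mem_ofPred_eq, hsum, ← sum_multisetOfCounts] at h
    simp only [← card_multisetOfCounts] at h
    exact ⟨h.2.1, (hcount p).2 fun i ↦ Nat.le_of_lt_succ (h.1.1 i),
      (hcount p').2 fun i ↦ Nat.le_of_lt_succ (h.1.2 i), h.2.2⟩

open LaurentPolynomial (T) in
/-- The generating function of `frobeniusPhi k` as a constant term. -/
lemma coeff_constTerm_eq_frobeniusPhi (R : Type*) [CommRing R] (k : ℕ) {n : ℕ} (hn : n < N) :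
    coeff n (constTerm (
      (∏ i ∈ Finset.range N, ∑ c ∈ Finset.range (k + 1),
        (LaurentPolynomial.C ((X : R⟦X⟧) ^ (i + 1)) * T 1) ^ c) *
      ∏ i ∈ Finset.range N, ∑ c ∈ Finset.range (k + 1),
        (LaurentPolynomial.C ((X : R⟦X⟧) ^ i) * T (-1)) ^ c)) = (frobeniusPhi k n : R) := by
  have hT : ∀ (f : Fin N → ℤ), ∏ i, (T (f i) : LaurentPolynomial R⟦X⟧) = T (∑ i, f i) := by
    intro f
    induction (Finset.univ : Finset (Fin N)) using Finset.cons_induction with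
    | empty => simp
    | cons a s ha ih => rw [Finset.prod_cons, Finset.sum_cons, ih, LaurentPolynomial.T_add]
  have hp : ∀ (e : Fin N → ℕ) (ε : ℤ) (p : Fin N → ℕ),
      ∏ i, (LaurentPolynomial.C ((X : R⟦X⟧) ^ e i) * T ε) ^ p i =
        LaurentPolynomial.C (X ^ ∑ i, e i * p i) * T (∑ i, p i * ε) := by
    intro e ε p
    simp only [mul_pow, LaurentPolynomial.T_pow, ← map_pow, ← pow_mul, Finset.prod_mul_distrib, hT,
      ← map_prod, Finset.prod_pow_eq_pow_sum]
  rw [Finset.prod_range, Finset.prod_range, Finset.prod_univ_sum, Finset.prod_univ_sum,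
    Finset.sum_mul_sum, ← Finset.sum_product', map_sum, map_sum, frobeniusPhi_eq_card k hn,
    Finset.card_filter, Nat.cast_sum]
  refine Finset.sum_congr rfl fun p _ ↦ ?_
  rw [hp (fun i ↦ i + 1), hp (fun i ↦ i), mul_mul_mul_comm, ← map_mul, ← pow_add,
    ← LaurentPolynomial.T_add, constTerm_C_mul, constTerm_T]
  have h1 : ∑ i, (p.1 i : ℤ) * 1 + ∑ i, (p.2 i : ℤ) * -1 = 0 ↔ ∑ i, p.1 i = ∑ i, p.2 i := by
    simp only [mul_one, mul_neg, Finset.sum_neg_distrib, add_neg_eq_zero]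
    exact_mod_cast Iff.rfl
  by_cases h : ∑ i, p.1 i = ∑ i, p.2 i
  · rw [if_pos (h1.2 h), mul_one, coeff_X_pow]
    simp only [h, true_and, eq_comm (a := n)]
    split_ifs <;> simp
  · rw [if_neg (fun h' ↦ h (h1.1 h')), if_neg (fun h' ↦ h h'.1)]
    simp

end Counting

section ModFive

/-- The generating function of `frobeniusPhi 4`, reduced modulo `5`. -/
noncomputable def phiFourSeries : (ZMod 5)⟦X⟧ := PowerSeries.mk fun n ↦ (frobeniusPhi 4 n : ZMod 5)

lemma geom_sum_five_eq {A : Type*} [CommRing A] (h : (5 : A) = 0) (x : A) :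
    ∑ c ∈ Finset.range 5, x ^ c = (1 - x) ^ 4 := by
  simp only [Finset.sum_range_succ, Finset.sum_range_zero]
  linear_combination (x - x ^ 2 + x ^ 3) * h

/-- Modulo `5`, the generating function of `frobeniusPhi 4` is that of the lattice `A₃` divided by the
fourth power of Euler's product. -/
theorem phiFourSeries_mul_eulerProd_pow_four :
    phiFourSeries * eulerProd (ZMod 5) ^ 4 = thetaA3 (ZMod 5) := by
  refine (eq_of_forall_X_pow_dvd_sub fun N ↦ ?_).symm
  have h5 : (5 : LaurentPolynomial (ZMod 5)⟦X⟧) = 0 := by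
    have h : LaurentPolynomial.C (PowerSeries.C (5 : ZMod 5)) = 5 := by
      rw [map_ofNat, map_ofNat]
    rw [← h, show (5 : ZMod 5) = 0 from rfl, map_zero, map_zero]
  have h1 : X ^ N ∣ phiFourSeries - constTerm (tripleProd (ZMod 5) N ^ 4) := by
    rw [X_pow_dvd_iff]
    intro n hn
    rw [map_sub, sub_eq_zero, phiFourSeries, coeff_mk,
      ← coeff_constTerm_eq_frobeniusPhi (ZMod 5) 4 hn, tripleProd, mul_pow, ← Finset.prod_pow,
      ← Finset.prod_pow]
    simp only [geom_sum_five_eq h5]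
  rw [show thetaA3 (ZMod 5) - phiFourSeries * eulerProd (ZMod 5) ^ 4 =
    (thetaA3 (ZMod 5) - eulerProd (ZMod 5) ^ 4 * constTerm (tripleProd (ZMod 5) N ^ 4)) -
    (phiFourSeries - constTerm (tripleProd (ZMod 5) N ^ 4)) * eulerProd (ZMod 5) ^ 4 by ring]
  exact dvd_sub (X_pow_dvd_thetaA3_sub_eulerProd_pow_four_mul _ N) (Dvd.dvd.mul_right h1 _)

end ModFive

/-! ### Theta series at `X` and at `-X` -/

section ThetaNeg
variable (R : Type*) [CommRing R]

lemma coeff_evalNegHom (g : R⟦X⟧) (n : ℕ) : coeff n (evalNegHom g) = (-1) ^ n * coeff n g :=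
  coeff_rescale g (-1) n

lemma evalNegHom_expand {m : ℕ} (hm : m ≠ 0) (he : Even m) (g : R⟦X⟧) :
    evalNegHom (expand m hm g) = expand m hm g := by
  ext n
  rw [coeff_evalNegHom, coeff_expand]
  split_ifs with h
  · rw [(he.trans_dvd h).neg_one_pow, one_mul]
  · simp

lemma evalNegHom_thetaPhi_sq : evalNegHom (thetaPhi R) ^ 2 =
    expand 2 two_ne_zero (thetaPhi R) ^ 2 - X * expand 2 two_ne_zero (thetaPronic R) ^ 2 := by
  rw [← map_pow, thetaPhi_sq, map_add, map_mul, map_pow, map_pow,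
    evalNegHom_expand R _ even_two, evalNegHom_expand R _ even_two, evalNegHom_X]
  ring

/-- The relation `φ(-X²)² = φ(X) φ(-X)`. -/
lemma expand_evalNegHom_thetaPhi_sq :
    expand 2 two_ne_zero (evalNegHom (thetaPhi R)) ^ 2 = thetaPhi R * evalNegHom (thetaPhi R) := by
  have h4 : ∀ g : R⟦X⟧, expand 2 two_ne_zero (expand 2 two_ne_zero g) =
      expand 4 four_ne_zero g := fun g ↦ (expand_mul 2 two_ne_zero 2 two_ne_zero g).symm
  have h : evalNegHom (thetaPhi R) =
      expand 4 four_ne_zero (thetaPhi R) - X * expand 4 four_ne_zero (thetaPronic R) := by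
    have h4' : Even 4 := ⟨2, rfl⟩
    conv_lhs => rw [thetaPhi_eq, map_add, map_mul, evalNegHom_expand R _ h4',
      evalNegHom_expand R _ h4', evalNegHom_X]
    ring
  rw [← map_pow, evalNegHom_thetaPhi_sq, map_sub, map_mul, map_pow, map_pow, h4, h4, expand_X, h]
  linear_combination (X * expand 4 four_ne_zero (thetaPronic R) -
    expand 4 four_ne_zero (thetaPhi R)) * thetaPhi_eq R

/-- Jacobi's identity for the fourth powers of the theta constants. -/
lemma thetaPhi_pow_four_sub :
    thetaPhi R ^ 4 - evalNegHom (thetaPhi R) ^ 4 = X * thetaPronic R ^ 4 := by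
  linear_combination (thetaPhi R ^ 2 + evalNegHom (thetaPhi R) ^ 2) * thetaPhi_sq R -
    (thetaPhi R ^ 2 + evalNegHom (thetaPhi R) ^ 2) * evalNegHom_thetaPhi_sq R +
    2 * X * expand 2 two_ne_zero (thetaPronic R) ^ 2 * (thetaPhi_sq R + evalNegHom_thetaPhi_sq R) -
    X * (thetaPronic R ^ 2 + 2 * (expand 2 two_ne_zero (thetaPronic R) *
      expand 2 two_ne_zero (thetaPhi R))) * thetaPronic_sq R

/-- The even part of `Θ(X) φ(X)²`, where `Θ` is the theta series of `A₃`. -/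
lemma exists_thetaA3_mul_thetaPhi_sq : ∃ U : R⟦X⟧, thetaA3 R * thetaPhi R ^ 2 =
    expand 2 two_ne_zero
      (4 * thetaPhi R ^ 5 - 3 * (thetaPhi R * evalNegHom (thetaPhi R) ^ 4)) +
      X * expand 2 two_ne_zero U := by
  refine ⟨4 * thetaPhi R ^ 3 * thetaPronic R ^ 2, ?_⟩
  have h : 4 * thetaPhi R ^ 5 - 3 * (thetaPhi R * evalNegHom (thetaPhi R) ^ 4) =
      thetaPhi R ^ 5 + 3 * (thetaPhi R * (X * thetaPronic R ^ 4)) := by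
    rw [← thetaPhi_pow_four_sub]
    ring
  rw [h, thetaA3_eq, thetaPhi_sq]
  simp only [map_add, map_mul, map_pow, map_ofNat, expand_X]
  ring

end ThetaNeg

/-! ### Extraction of the even part -/

section EvenPart
variable {R : Type*} [CommRing R]

/-- The power series formed by the coefficients of even index. -/
noncomputable def evenPart (g : R⟦X⟧) : R⟦X⟧ := PowerSeries.mk fun n ↦ coeff (2 * n) g

lemma eq_expand_evenPart_add (g : R⟦X⟧) : ∃ U : R⟦X⟧,
    g = expand 2 two_ne_zero (evenPart g) + X * expand 2 two_ne_zero U := by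
  refine ⟨PowerSeries.mk fun n ↦ coeff (2 * n + 1) g, ?_⟩
  ext n
  rcases Nat.even_or_odd' n with ⟨k, rfl | rfl⟩
  · rw [map_add, coeff_expand_mul, evenPart, coeff_mk]
    cases k with
    | zero => simp
    | succ k =>
      rw [show 2 * (k + 1) = 2 * k + 1 + 1 by ring, coeff_succ_X_mul,
        coeff_expand_of_not_dvd _ _ _ (by omega), add_zero]
  · rw [map_add, coeff_succ_X_mul, coeff_expand_mul, coeff_mk,
      coeff_expand_of_not_dvd _ _ _ (by omega), zero_add]

lemma expand_add_X_mul_expand_inj {a b c d : R⟦X⟧}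
    (h : expand 2 two_ne_zero a + X * expand 2 two_ne_zero b =
      expand 2 two_ne_zero c + X * expand 2 two_ne_zero d) : a = c := by
  have key : ∀ (u v : R⟦X⟧) (n : ℕ),
      coeff (2 * n) (expand 2 two_ne_zero u + X * expand 2 two_ne_zero v) = coeff n u := by
    intro u v n
    rw [map_add, coeff_expand_mul]
    cases n with
    | zero => simp
    | succ k =>
      rw [show 2 * (k + 1) = 2 * k + 1 + 1 by ring, coeff_succ_X_mul,
        coeff_expand_of_not_dvd _ _ _ (by omega), add_zero]
  ext n
  rw [← key a b n, h, key]

end EvenPart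

/-! ### The congruence -/

section Congruence

lemma pow_five_eq_expand (g : (ZMod 5)⟦X⟧) : g ^ 5 = expand 5 (by norm_num) g := by
  have : Fact (Nat.Prime 5) := ⟨by norm_num⟩
  have h := MvPowerSeries.map_frobenius_expand (R := ZMod 5) 5 (by norm_num) (f := g)
  rw [ZMod.frobenius_zmod, MvPowerSeries.map_id] at h
  exact h.symm

/-- The even part of the generating function, multiplied by a power series in `X ^ 5`. -/
lemma evenPart_phiFourSeries_mul :
    evenPart phiFourSeries * expand 5 (by norm_num)
      (evalNegHom (thetaPhi (ZMod 5)) * eulerProd (ZMod 5)) =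
    4 * expand 5 (by norm_num) (thetaPhi (ZMod 5)) *
        (evalNegHom (thetaPhi (ZMod 5)) * eulerProd (ZMod 5) ^ 3) -
      3 * expand 5 (by norm_num) (evalNegHom (thetaPhi (ZMod 5))) *
        (thetaPhi (ZMod 5) * eulerProd (ZMod 5) ^ 3) := by
  obtain ⟨V, hV⟩ := eq_expand_evenPart_add phiFourSeries
  obtain ⟨U, hU⟩ := exists_thetaA3_mul_thetaPhi_sq (ZMod 5)
  have h1 := phiFourSeries_mul_eulerProd_pow_four
  have h2 := evalNegHom_thetaPhi_mul_expand_eulerProd (ZMod 5)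
  have h3 := expand_evalNegHom_thetaPhi_sq (ZMod 5)
  set F := phiFourSeries
  set E := eulerProd (ZMod 5)
  set p := thetaPhi (ZMod 5)
  set m := evalNegHom p
  have h4 : F * expand 2 two_ne_zero (m ^ 4 * E ^ 2) =
      expand 2 two_ne_zero (4 * p ^ 5 - 3 * (p * m ^ 4)) + X * expand 2 two_ne_zero U := by
    rw [← hU, ← h1, map_mul, map_pow, map_pow,
      show E ^ 4 = (E ^ 2) ^ 2 by ring, ← h2, show ∀ a : (ZMod 5)⟦X⟧, a ^ 4 = (a ^ 2) ^ 2 by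
        intro a; ring, h3]
    ring
  have h5 : evenPart F * (m ^ 4 * E ^ 2) = 4 * p ^ 5 - 3 * (p * m ^ 4) := by
    refine expand_add_X_mul_expand_inj (b := V * (m ^ 4 * E ^ 2)) (d := U) ?_
    rw [← h4]
    nth_rewrite 2 [hV]
    simp only [map_mul]
    ring
  simp only [map_mul, ← pow_five_eq_expand]
  linear_combination (m * E ^ 3) * h5

/-- As `8 * (x ^ 2 + tri j) = 8 * x ^ 2 + (2 * j + 1) ^ 2 - 1`, and `-8` is not a square modulo
`5`, an exponent congruent to `3` forces `5 ∣ 2 * j + 1`. -/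
lemma two_mul_add_one_cast_eq_zero {x j : ℤ} {n : ℕ} (h : x ^ 2 + tri j = (5 * n + 3 : ℕ)) :
    ((2 * j + 1 : ℤ) : ZMod 5) = 0 := by
  have h1 : 2 * x ^ 2 + j * (j + 1) = 10 * n + 6 := by
    have := two_mul_tri j
    push_cast at h
    linarith
  have h2 := congrArg (Int.cast : ℤ → ZMod 5) h1
  have h10 : (10 : ZMod 5) = 0 := rfl
  push_cast [h10] at h2 ⊢
  generalize (x : ZMod 5) = x at h2
  generalize (j : ZMod 5) = j at h2
  rw [zero_mul] at h2
  revert x j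
  decide

/-- For weights `1` and `(-1) ^ x` the first factor is `φ(X)` and `φ(-X)`. -/
lemma coeff_qSeries_sq_mul_eulerProd_pow_three (w : ℤ → ZMod 5) (n : ℕ) :
    coeff (5 * n + 3) (qSeries (fun x : ℤ ↦ x ^ 2) w * eulerProd (ZMod 5) ^ 3) = 0 := by
  -- `2 * 3 = 1` in `ZMod 5`
  have h : eulerProd (ZMod 5) ^ 3 = 3 * (2 * eulerProd (ZMod 5) ^ 3) := by
    have h6 : (6 : (ZMod 5)⟦X⟧) = 1 := by
      rw [← map_ofNat (C (R := ZMod 5)) 6, show (OfNat.ofNat 6 : ZMod 5) = 1 from rfl, map_one]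
    linear_combination (-eulerProd (ZMod 5) ^ 3) * h6
  rw [h, two_mul_eulerProd_pow_three, mul_left_comm, qSeries_mul isExponent_sq isExponent_tri,
    ← map_ofNat (C (R := ZMod 5)) 3, coeff_C_mul, coeff_qSeries,
    finsum_mem_eq_zero_of_forall_eq_zero, mul_zero]
  rintro ⟨x, j⟩ h
  rw [two_mul_add_one_cast_eq_zero h, mul_zero, mul_zero]

/-- Multiplication by a series in `X ^ m` does not mix residue classes of exponents modulo `m`. -/
lemma coeff_expand_mul_eq_zero {m r : ℕ} (hm : m ≠ 0) {R : Type*} [CommRing R] {g : R⟦X⟧}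
    (hr : r < m) (hg : ∀ n, coeff (m * n + r) g = 0) (u : R⟦X⟧) (n : ℕ) :
    coeff (m * n + r) (expand m hm u * g) = 0 := by
  rw [coeff_mul]
  refine Finset.sum_eq_zero fun p hp ↦ ?_
  rw [Finset.HasAntidiagonal.mem_antidiagonal] at hp
  by_cases h : m ∣ p.1
  · obtain ⟨k, hk⟩ := h
    have hkn : k ≤ n := by
      by_contra! hlt
      have := Nat.mul_le_mul_left m hlt
      rw [Nat.succ_eq_add_one, mul_add] at this
      omega
    have : p.2 = m * (n - k) + r := by
      have := Nat.mul_sub m n k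
      have := Nat.mul_le_mul_left m hkn
      omega
    rw [this, hg, mul_zero]
  · rw [coeff_expand_of_not_dvd _ _ _ h, zero_mul]

theorem theorem3 (n : ℕ) : frobeniusPhi 4 (10 * n + 6) ≡ 0 [MOD 5] := by
  rw [← ZMod.natCast_eq_natCast_iff, Nat.cast_zero]
  set D := evalNegHom (thetaPhi (ZMod 5)) * eulerProd (ZMod 5)
  have hunit : IsUnit D := by
    refine IsUnit.mul ?_ (isUnit_eulerProd _)
    refine (isUnit_of_mul_isUnit_left (y := expand 2 two_ne_zero (eulerProd (ZMod 5))) ?_)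
    rw [evalNegHom_thetaPhi_mul_expand_eulerProd]
    exact (isUnit_eulerProd _).pow 2
  obtain ⟨D', hD'⟩ := hunit.exists_right_inv
  have hinv : expand 5 (by norm_num) D * expand 5 (by norm_num) D' = 1 := by
    rw [← map_mul, hD', map_one]
  have key : evenPart phiFourSeries = expand 5 (by norm_num) D' *
      (evenPart phiFourSeries * expand 5 (by norm_num) D) := by
    linear_combination (-evenPart phiFourSeries) * hinv
  have h : coeff (5 * n + 3) (evenPart phiFourSeries) = 0 := by
    rw [key, evenPart_phiFourSeries_mul]
    refine coeff_expand_mul_eq_zero _ (by norm_num) (fun k ↦ ?_) D' n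
    have h1 := coeff_expand_mul_eq_zero (m := 5) (r := 3) (by norm_num) (by norm_num)
      (coeff_qSeries_sq_mul_eulerProd_pow_three 1) (3 * evalNegHom (thetaPhi (ZMod 5))) k
    have h2 := coeff_expand_mul_eq_zero (m := 5) (r := 3) (by norm_num) (by norm_num)
      (coeff_qSeries_sq_mul_eulerProd_pow_three fun j ↦ (-1) ^ j.natAbs)
      (4 * thetaPhi (ZMod 5)) k
    rw [← evalNegHom_thetaPhi, map_mul (expand 5 _), map_ofNat] at h2
    rw [← thetaPhi, map_mul (expand 5 _), map_ofNat] at h1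
    rw [map_sub, h1, h2, sub_zero]
  rw [evenPart, coeff_mk, phiFourSeries, coeff_mk] at h
  rw [← h]
  congr 2
  ring

end Congruence
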